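/- Let $X$ be a real Banach space, $U\subset X$ an open neighbourhood of $0$, $M$ a smooth ($C^\infty$) manifold of finite dimension $m$, and $F:U\to M$ a $C^\infty$ map. Let $\mathrm{coker}(d_0F)=T_{F(0)}M/\mathrm{Im}(d_0F)$, with quotient map $\pi$. Suppose that $0$ is a critical point of $F$ (i.e. $d_0F:X\to T_{F(0)}M$ is not surjective) of corank $h=\dim \mathrm{coker}(d_0F)\ge 1$. Fix any smooth chart of $M$ around $F(0)$, and let $d_0^2F(\cdot,\cdot)$ and $d_0^3F(\cdot,\cdot,\cdot)$ be the symmetric bilinear and trilinear maps given by the second and third derivatives at $0$ of $F$ read in this chart; their values are regarded as elements of $T_{F(0)}M$ through the differential of the chart. Define: - the intrinsic Hessian $\mathcal D_0^2F(v,w)=\pi\big(d_0^2F(v,w)\big)$ for $v,w\in\ker(d_0F)$, with $\mathcal D_0^2F(v)=\mathcal D_0^2F(v,v)$; - the set of isotropic vectors $\mathrm{Iso}(\mathcal D_0^2F)=\{w\in\ker(d_0F):\mathcal D_0^2F(w)=0\}$; - the domain $\mathrm{dom}(\mathcal D_0^3F)=\{v\in\ker(d_0F):\pi(d_0^2F(v,x))=0\text{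 for all }x\in X\}$, a linear subspace of $X$; - the intrinsic third differential $\mathcal D_0^3F(u,v,w)=\pi\big(d_0^3F(u,v,w)\big)$ for $u,v,w\in \mathrm{dom}(\mathcal D_0^3F)$, with $\mathcal D_0^3F(v)=\mathcal D_0^3F(v,v,v)$; - for $w_0\in\mathrm{Iso}(\mathcal D_0^2F)$, the subspace $\mathrm{Im}(F,2,w_0)=\{\mathcal D_0^2F(w_0,w):w\in\ker(d_0F)\}$ of $\mathrm{coker}(d_0F)$ and the quotient $\mathrm{coker}(F,2,w_0)=\mathrm{coker}(d_0F)/\mathrm{Im}(F,2,w_0)$. A vector $v\in\mathrm{dom}(\mathcal D_0^3F)$ is a $w_0$-regular zero of $\mathcal D_0^3F$ if $\mathcal D_0^3F(v)=0$ and the linear map $\mathrm{dom}(\mathcal D_0^3F)\to\mathrm{coker}(F,2,w_0)$, $x\mapsto \mathcal D_0^3F(v,v,x) \bmod \mathrm{Im}(F,2,w_0)$, is surjective. The map $F$ is open at $0$ if it maps every neighbourhood of $0$ onto a neighbourhood of $F(0)$. Then: (i) If $h=1$ and there exists $v\in\mathrm{dom}(\mathcal D_0^3F)$ with $\mathcal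 D_0^3F(v)\neq0$, then $F$ is open at $0$. (ii) For any $h\ge1$, if there exist $w_0\in\mathrm{Iso}(\mathcal D_0^2F)$ and $v_0\in\mathrm{dom}(\mathcal D_0^3F)$ such that $v_0$ is a $w_0$-regular zero of $\mathcal D_0^3F$, then $F$ is open at $0$. -/

import Mathlib

open scoped Manifold ContDiff Topology

noncomputable section

namespace ThirdOrder

variable {X : Type*} [NormedAddCommGroup X] [NormedSpace ℝ X]
  {m : ℕ} {M : Type*} [TopologicalSpace M] [ChartedSpace (EuclideanSpace ℝ (Fin m)) M]

/-- `F` is open at `x`: it maps every neighbourhood of `x` onto a neighbourhood of `F x`. -/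
def IsOpenAt {A B : Type*} [TopologicalSpace A] [TopologicalSpace B] (F : A → B) (x : A) : Prop :=
  ∀ N ∈ 𝓝 x, F '' N ∈ 𝓝 (F x)

/-- The differential `d₀F : X → T_{F(0)} M`. -/
def diff (m : ℕ) {M : Type*} [TopologicalSpace M] [ChartedSpace (EuclideanSpace ℝ (Fin m)) M]
    (F : X → M) : X →L[ℝ] TangentSpace (𝓡 m) (F 0) :=
  mfderiv 𝓘(ℝ, X) (𝓡 m) F 0

/-- The kernel of `d₀F`. -/
abbrev kerD (m : ℕ) {M : Type*} [TopologicalSpace M] [ChartedSpace (EuclideanSpace ℝ (Fin m)) M]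
    (F : X → M) : Submodule ℝ X :=
  (diff m F).toLinearMap.ker

/-- The cokernel `T_{F(0)} M / Im (d₀F)`. -/
abbrev Coker (m : ℕ) {M : Type*} [TopologicalSpace M] [ChartedSpace (EuclideanSpace ℝ (Fin m)) M]
    (F : X → M) : Type :=
  TangentSpace (𝓡 m) (F 0) ⧸ (diff m F).toLinearMap.range

/-- `0` is a critical point of `F`: the differential `d₀F` is not surjective. -/
def IsCriticalAtZero (m : ℕ) {M : Type*} [TopologicalSpace M]
    [ChartedSpace (EuclideanSpace ℝ (Fin m)) M] (F : X → M) : Prop :=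
  ¬ Function.Surjective (diff m F)

/-- The corank of `F` at `0`: the dimension of the cokernel of `d₀F`. -/
def corank (m : ℕ) {M : Type*} [TopologicalSpace M]
    [ChartedSpace (EuclideanSpace ℝ (Fin m)) M] (F : X → M) : ℕ :=
  Module.finrank ℝ (Coker m F)

/-- The second derivative at `0`, as a bilinear map, of the representative `e ∘ F` of `F` in the
chart `e`. -/
def chartD2 (e : OpenPartialHomeomorph M (EuclideanSpace ℝ (Fin m))) (F : X → M) :
    X →L[ℝ] X →L[ℝ] EuclideanSpace ℝ (Fin m) :=
  fderiv ℝ (fderiv ℝ (fun u => e (F u))) 0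

/-- The third derivative at `0`, as a trilinear map, of the representative `e ∘ F` of `F` in the
chart `e`. -/
def chartD3 (e : OpenPartialHomeomorph M (EuclideanSpace ℝ (Fin m))) (F : X → M) :
    X →L[ℝ] X →L[ℝ] X →L[ℝ] EuclideanSpace ℝ (Fin m) :=
  fderiv ℝ (fderiv ℝ (fderiv ℝ (fun u => e (F u)))) 0

/-- The identification `ℝᵐ → T_{F(0)} M` given by the chart `e`, that is the inverse of the
differential of `e` at `F 0`. -/
def ofChart (e : OpenPartialHomeomorph M (EuclideanSpace ℝ (Fin m))) (F : X → M) :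
    EuclideanSpace ℝ (Fin m) →L[ℝ] TangentSpace (𝓡 m) (F 0) :=
  ContinuousLinearMap.inverse (mfderiv (𝓡 m) 𝓘(ℝ, EuclideanSpace ℝ (Fin m)) e (F 0))

/-- The projection onto the cokernel of `d₀F`, for vectors of `ℝᵐ` regarded as tangent vectors at
`F 0` by means of the chart `e`. -/
def proj (e : OpenPartialHomeomorph M (EuclideanSpace ℝ (Fin m))) (F : X → M) :
    EuclideanSpace ℝ (Fin m) →ₗ[ℝ] Coker m F :=
  (diff m F).toLinearMap.range.mkQ ∘ₗ (ofChart e F).toLinearMap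

/-- The intrinsic Hessian as a bilinear map, `w ↦ 𝓓²F(v, w)` on the kernel of `d₀F`. -/
def hessBilin (e : OpenPartialHomeomorph M (EuclideanSpace ℝ (Fin m))) (F : X → M)
    (v : kerD m F) : kerD m F →ₗ[ℝ] Coker m F :=
  proj e F ∘ₗ (chartD2 e F v).toLinearMap ∘ₗ (kerD m F).subtype

/-- The intrinsic Hessian, the quadratic map `v ↦ 𝓓²F(v)` on the kernel of `d₀F`. -/
def hess (e : OpenPartialHomeomorph M (EuclideanSpace ℝ (Fin m))) (F : X → M)
    (v : kerD m F) : Coker m F :=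
  hessBilin e F v v

/-- The set of isotropic vectors of the intrinsic Hessian. -/
def Iso (e : OpenPartialHomeomorph M (EuclideanSpace ℝ (Fin m))) (F : X → M) :
    Set (kerD m F) :=
  {w | hess e F w = 0}

/-- The domain of the intrinsic third differential: those `v` in the kernel of `d₀F` for which
`d²₀F(v, x)` projects to zero in the cokernel for all `x` in `X`. -/
def dom (e : OpenPartialHomeomorph M (EuclideanSpace ℝ (Fin m))) (F : X → M) :
    Submodule ℝ X where
  carrier := {v | v ∈ kerD m F ∧ ∀ x : X, proj e F (chartD2 e F v x) = 0}
  add_mem' := fun {a b} ha hb => ⟨(kerD m F).add_mem ha.1 hb.1, fun x => by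
    rw [map_add, add_apply, map_add, ha.2 x, hb.2 x, add_zero]⟩
  zero_mem' := ⟨(kerD m F).zero_mem, fun x => by
    rw [map_zero, zero_apply, map_zero]⟩
  smul_mem' := fun c v hv => ⟨(kerD m F).smul_mem c hv.1, fun x => by
    rw [map_smul, smul_apply, map_smul, hv.2 x, smul_zero]⟩

/-- The intrinsic third differential as a trilinear map, `x ↦ 𝓓³F(u, v, x)` on its domain. -/
def thirdTrilin (e : OpenPartialHomeomorph M (EuclideanSpace ℝ (Fin m))) (F : X → M)
    (u v : dom e F) : dom e F →ₗ[ℝ] Coker m F :=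
  proj e F ∘ₗ (chartD3 e F u v).toLinearMap ∘ₗ (dom e F).subtype

/-- The intrinsic third differential, the cubic map `v ↦ 𝓓³F(v)` on its domain. -/
def third (e : OpenPartialHomeomorph M (EuclideanSpace ℝ (Fin m))) (F : X → M)
    (v : dom e F) : Coker m F :=
  thirdTrilin e F v v v

/-- The second-order image `Im(F, 2, w₀) = Im 𝓓²F(w₀, ·)`, a subspace of the cokernel. -/
def secondImage (e : OpenPartialHomeomorph M (EuclideanSpace ℝ (Fin m))) (F : X → M)
    (w₀ : kerD m F) : Submodule ℝ (Coker m F) :=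
  (hessBilin e F w₀).range

/-- The second-order cokernel `coker(F, 2, w₀) = coker(d₀F) / Im(F, 2, w₀)`. -/
abbrev SecondCoker (e : OpenPartialHomeomorph M (EuclideanSpace ℝ (Fin m))) (F : X → M)
    (w₀ : kerD m F) : Type :=
  Coker m F ⧸ secondImage e F w₀

/-- `v` is a `w₀`-regular zero of the intrinsic third differential. -/
def IsRegularZero (e : OpenPartialHomeomorph M (EuclideanSpace ℝ (Fin m))) (F : X → M)
    (w₀ : kerD m F) (v : dom e F) : Prop :=
  third e F v = 0 ∧
    Function.Surjective
      (fun x : dom e F =>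
        ((secondImage e F w₀).mkQ (thirdTrilin e F v v x) : SecondCoker e F w₀))

end ThirdOrder

end

/-! In a chart, `F` becomes a C⁴ map `f` into a finite-dimensional space `E`. Write L, B, T for its
first three derivatives at 0. Being zero in the cokernel means lying in the range of L.

Regular zeros, any corank: evaluate `f` along x = ε²v + ε³w + ε⁴a + ε⁵b + ε⁶y, where v, w, a, b, y
depend on a parameter z in `E`. With v in the domain of the third differential and w in ker L, the
vectors a and b can be chosen to cancel orders four and five, because B(v, ·) takes values in the
range of L. The coefficient of ε⁶ is Ly + B(v, a) + B(w, w)/2 + T(v, v, v)/6, and y absorbs B(v, a).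
Perturbing v₀, w₀ and y linearly in z, the regularity condition says precisely that the linear part
of this coefficient can be made the identity of `E`. The Taylor remainder has size ε⁸, so (f(x) -
f(0)) / ε⁶ is a small Lipschitz perturbation of a local diffeomorphism and covers a ball. The two
halves are `isOpenAt_of_weighted_expansion` and `isOpenAt_of_regularZero`.

Corank one: Lyapunov–Schmidt reduction (`isOpenAt_of_third_ne_zero`). Solving the equation in the
range of L leaves one scalar function; along the axis it equals ct³ + O(t⁴) with c ≠ 0, so it
changes sign, and the intermediate value theorem solves the last equation. -/

namespace ThirdOrder

set_option maxSynthPendingDepth 3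

/-! ### Third order Taylor expansion with a Lipschitz remainder -/

section Taylor

variable {X E : Type*} [NormedAddCommGroup X] [NormedSpace ℝ X]
  [NormedAddCommGroup E] [NormedSpace ℝ E]

/-- A map whose derivative is `O(‖x‖ ^ k)` is Lipschitz with constant `C * ρ ^ k` on the ball of
radius `ρ`, for `ρ` small. -/
theorem exists_lipschitz_of_hasFDerivAt {g : X → E} {g' : X → X →L[ℝ] E} {k : ℕ}
    (hg : ∀ᶠ x in 𝓝 (0 : X), HasFDerivAt g (g' x) x)
    (hb : g' =O[𝓝 0] fun x => ‖x‖ ^ k) :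
    ∃ C > 0, ∃ δ > 0, ∀ ρ < δ, ∀ x y : X, ‖x‖ ≤ ρ → ‖y‖ ≤ ρ →
      ‖g x - g y‖ ≤ C * ρ ^ k * ‖x - y‖ := by
  obtain ⟨C, hC, hCb⟩ := hb.exists_pos
  obtain ⟨δ, hδ, hball⟩ := Metric.eventually_nhds_iff.1 (hg.and hCb.bound)
  refine ⟨C, hC, δ, hδ, fun ρ hρ x y hx hy => ?_⟩
  have hmem : ∀ u ∈ Metric.closedBall (0 : X) ρ, dist u 0 < δ := fun u hu =>
    (Metric.mem_closedBall.1 hu).trans_lt hρ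
  refine (convex_closedBall (0 : X) ρ).norm_image_sub_le_of_norm_hasFDerivWithin_le (f' := g')
    (fun u hu => (hball (hmem u hu)).1.hasFDerivWithinAt) (fun u hu => ?_)
    (by simpa using hy) (by simpa using hx)
  refine (hball (hmem u hu)).2.trans ?_
  rw [norm_pow, norm_norm]
  have : ‖u‖ ≤ ρ := by simpa using hu
  gcongr

/-- The Lipschitz bound is applied between `x` and 0 on the ball of radius `‖x‖`: integration gains
one order. -/
theorem isBigO_of_hasFDerivAt {g : X → E} {g' : X → X →L[ℝ] E} {k : ℕ}
    (hg : ∀ᶠ x in 𝓝 (0 : X), HasFDerivAt g (g' x) x) (h0 : g 0 = 0)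
    (hb : g' =O[𝓝 0] fun x => ‖x‖ ^ k) : g =O[𝓝 0] fun x => ‖x‖ ^ (k + 1) := by
  obtain ⟨C, -, δ, hδ, h⟩ := exists_lipschitz_of_hasFDerivAt hg hb
  refine Asymptotics.IsBigO.of_bound C ?_
  filter_upwards [Metric.ball_mem_nhds (0 : X) hδ] with x hx
  have := h ‖x‖ (by simpa using hx) x 0 le_rfl (by simp)
  rw [h0, sub_zero, sub_zero] at this
  rwa [norm_pow, norm_norm, pow_succ, ← mul_assoc]

variable {f : X → E}

theorem third_fderiv_symm_left (hf : ContDiffAt ℝ 4 f 0) (u v : X) :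
    fderiv ℝ (fderiv ℝ (fderiv ℝ f)) 0 u v = fderiv ℝ (fderiv ℝ (fderiv ℝ f)) 0 v u := by
  have h1 : ContDiffAt ℝ 3 (fderiv ℝ f) 0 := hf.fderiv_right (by norm_num)
  exact (h1.isSymmSndFDerivAt (by simp; norm_num)) u v

/-- The symmetry of the second derivative holds at every point near 0, so it can be differentiated.
-/
theorem third_fderiv_symm_right (hf : ContDiffAt ℝ 4 f 0) (u v w : X) :
    fderiv ℝ (fderiv ℝ (fderiv ℝ f)) 0 u v w = fderiv ℝ (fderiv ℝ (fderiv ℝ f)) 0 u w v := by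
  have h2 : ContDiffAt ℝ 2 (fderiv ℝ (fderiv ℝ f)) 0 :=
    (hf.fderiv_right (m := 3) (by norm_num)).fderiv_right (by norm_num)
  have hd : HasFDerivAt (fderiv ℝ (fderiv ℝ f)) (fderiv ℝ (fderiv ℝ (fderiv ℝ f)) 0) 0 :=
    (h2.differentiableAt (by norm_num)).hasFDerivAt
  have hev : ∀ᶠ x in 𝓝 (0 : X), fderiv ℝ (fderiv ℝ f) x v w = fderiv ℝ (fderiv ℝ f) x w v := by
    filter_upwards [hf.eventually (by simp)] with x hx
    exact (hx.isSymmSndFDerivAt (by simp; norm_num)) v w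
  have e1 := (hd.clm_apply (hasFDerivAt_const v (0 : X))).clm_apply (hasFDerivAt_const w (0 : X))
  have e2 := (hd.clm_apply (hasFDerivAt_const w (0 : X))).clm_apply (hasFDerivAt_const v (0 : X))
  have := e1.unique (e2.congr_of_eventuallyEq hev)
  simpa using congrArg (fun A => A u) this

/-- The remainder of the third order Taylor expansion of `f` at `0`. -/
noncomputable def taylorRemainder (f : X → E) (x : X) : E :=
  f x - (f 0 + fderiv ℝ f 0 x + (1 / 2 : ℝ) • fderiv ℝ (fderiv ℝ f) 0 x x +
    (1 / 6 : ℝ) • fderiv ℝ (fderiv ℝ (fderiv ℝ f)) 0 x x x)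

theorem taylorRemainder_zero : taylorRemainder f 0 = 0 := by simp [taylorRemainder]

/-- The third derivative is differentiable at 0, hence equals `T` up to O(‖x‖); integrating twice
gives the O(‖x‖³) bound for the first derivative. Symmetry of `B` and `T` identifies the derivatives
of the Taylor polynomials. -/
theorem exists_fderiv_taylorRemainder (hf : ContDiffAt ℝ 4 f 0) :
    ∃ g' : X → X →L[ℝ] E, (∀ᶠ x in 𝓝 (0 : X), HasFDerivAt (taylorRemainder f) (g' x) x) ∧
      g' =O[𝓝 0] fun x => ‖x‖ ^ 3 := by
  set L := fderiv ℝ f 0 with hL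
  set B := fderiv ℝ (fderiv ℝ f) 0 with hB
  set T := fderiv ℝ (fderiv ℝ (fderiv ℝ f)) 0 with hT
  have h1 : ContDiffAt ℝ 3 (fderiv ℝ f) 0 := hf.fderiv_right (by norm_num)
  have h2 : ContDiffAt ℝ 2 (fderiv ℝ (fderiv ℝ f)) 0 := h1.fderiv_right (by norm_num)
  have h3 : ContDiffAt ℝ 1 (fderiv ℝ (fderiv ℝ (fderiv ℝ f))) 0 := h2.fderiv_right (by norm_num)
  have hBs : ∀ u v, B u v = B v u := (hf.isSymmSndFDerivAt (by simp; norm_num))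
  have hTl : ∀ u v, T u v = T v u := third_fderiv_symm_left hf
  have hTr : ∀ u v w, T u v w = T u w v := third_fderiv_symm_right hf
  have o3 : (fun x => fderiv ℝ (fderiv ℝ (fderiv ℝ f)) x - T) =O[𝓝 0] fun x => ‖x‖ ^ 1 := by
    simpa using (h3.differentiableAt (by norm_num)).isBigO_sub.norm_right
  have o2 : (fun x => fderiv ℝ (fderiv ℝ f) x - (B + T x)) =O[𝓝 0] fun x => ‖x‖ ^ 2 := by
    refine isBigO_of_hasFDerivAt ?_ (by simp [hB]) o3
    filter_upwards [h2.eventually (by simp)] with x hx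
    exact (hx.differentiableAt (by norm_num)).hasFDerivAt.sub (T.hasFDerivAt.const_add B)
  have o1 : (fun x => fderiv ℝ f x - (L + B x + (1 / 2 : ℝ) • T x x)) =O[𝓝 0]
      fun x => ‖x‖ ^ 3 := by
    refine isBigO_of_hasFDerivAt ?_ (by simp [hL]) o2
    filter_upwards [h1.eventually (by simp)] with x hx
    refine ((hx.differentiableAt (by norm_num)).hasFDerivAt.sub ((B.hasFDerivAt.const_add L).add
      ((T.hasFDerivAt.clm_apply (hasFDerivAt_id x)).const_smul (1 / 2 : ℝ)))).congr_fderiv ?_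
    ext u w
    simp [hTl u x]
    module
  refine ⟨_, ?_, o1⟩
  filter_upwards [hf.eventually (by simp)] with x hx
  refine ((hx.differentiableAt (by norm_num)).hasFDerivAt.sub (((L.hasFDerivAt.const_add (f 0)).add
    ((B.hasFDerivAt.clm_apply (hasFDerivAt_id x)).const_smul (1 / 2 : ℝ))).add
    (((T.hasFDerivAt.clm_apply (hasFDerivAt_id x)).clm_apply
      (hasFDerivAt_id x)).const_smul (1 / 6 : ℝ)))).congr_fderiv ?_
  ext u
  simp [hTl u x, hTr x u x, hBs u x]
  module

end Taylor

/-! ### Weighted curves and openness from the sixth order coefficient -/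

section Weighted

variable {X E : Type*} [NormedAddCommGroup X] [NormedSpace ℝ X]
  [NormedAddCommGroup E] [NormedSpace ℝ E]

/-- The term of order `ε ^ 7` and higher in the cubic polynomial `L + B / 2 + T / 6` along
`ε² v + ε³ w + ε⁴ a + ε⁵ b + ε⁶ y`, divided by `ε ^ 7`. -/
noncomputable def weightedTail (B : X →L[ℝ] X →L[ℝ] E) (T : X →L[ℝ] X →L[ℝ] X →L[ℝ] E)
    (ε : ℝ) (v w a b y : X) : E :=
  (1 / 2 : ℝ) • (B v (b + ε • y) + B (b + ε • y) v + B w (a + ε • b + ε ^ 2 • y) +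
    B (a + ε • b + ε ^ 2 • y) w +
    ε • B (a + ε • b + ε ^ 2 • y) (a + ε • b + ε ^ 2 • y)) +
  (1 / 6 : ℝ) • (T (w + ε • (a + ε • b + ε ^ 2 • y)) v v +
    T v (w + ε • (a + ε • b + ε ^ 2 • y)) v + T v v (w + ε • (a + ε • b + ε ^ 2 • y)) +
    ε • (T (w + ε • (a + ε • b + ε ^ 2 • y)) (w + ε • (a + ε • b + ε ^ 2 • y)) v +
      T (w + ε • (a + ε • b + ε ^ 2 • y)) v (w + ε • (a + ε • b + ε ^ 2 • y)) +
      T v (w + ε • (a + ε • b + ε ^ 2 • y)) (w + ε • (a + ε • b + ε ^ 2 • y))) +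
    ε ^ 2 • T (w + ε • (a + ε • b + ε ^ 2 • y)) (w + ε • (a + ε • b + ε ^ 2 • y))
      (w + ε • (a + ε • b + ε ^ 2 • y)))

/-- Orders two and three vanish since `v` and `w` lie in the kernel, orders four and five by the
choice of `a` and `b`; `T` only enters at order six. Products are kept in both orders, so no
symmetry is needed. -/
theorem cubic_weighted_eq (L : X →L[ℝ] E) (B : X →L[ℝ] X →L[ℝ] E)
    (T : X →L[ℝ] X →L[ℝ] X →L[ℝ] E) (ε : ℝ) {v w a b y : X} (hv : L v = 0) (hw : L w = 0)
    (ha : L a = -((1 / 2 : ℝ) • B v v)) (hb : L b = -((1 / 2 : ℝ) • (B v w + B w v)))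
    {x : X} (hx : x = ε ^ 2 • (v + ε • (w + ε • (a + ε • b + ε ^ 2 • y)))) :
    L x + (1 / 2 : ℝ) • B x x + (1 / 6 : ℝ) • T x x x =
      ε ^ 6 • (L y + (1 / 2 : ℝ) • (B v a + B a v + B w w) + (1 / 6 : ℝ) • T v v v +
        ε • weightedTail B T ε v w a b y) := by
  have hB : B x x = ε ^ 4 • (B v v + ε • (B v w + B w v) + ε ^ 2 • (B v a + B a v + B w w)) +
      ε ^ 7 • (B v (b + ε • y) + B (b + ε • y) v + B w (a + ε • b + ε ^ 2 • y) +
        B (a + ε • b + ε ^ 2 • y) w +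
        ε • B (a + ε • b + ε ^ 2 • y) (a + ε • b + ε ^ 2 • y)) := by
    rw [hx]
    simp only [map_add, map_smul, add_apply, smul_apply]
    module
  have hL : L x = -(ε ^ 4 • ((1 / 2 : ℝ) • (B v v + ε • (B v w + B w v)))) + ε ^ 6 • L y := by
    rw [hx]
    simp only [map_add, map_smul, hv, hw, ha, hb]
    module
  rw [hL, hB, hx, weightedTail]
  -- The cubic term sees only x = ε²(v + εu), so the inner bracket can stay opaque.
  generalize w + ε • (a + ε • b + ε ^ 2 • y) = u
  simp only [map_add, map_smul, add_apply, smul_apply]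
  module

/-- If along `ε² v(z) + ε³ w(z) + ε⁴ a(z) + ε⁵ b(z) + ε⁶ y(z)` the Taylor polynomial of `f` starts
at order six, and its sixth order coefficient `Φ` is a local diffeomorphism at a zero, then `f` is
open at `0`. -/
theorem isOpenAt_of_weighted_expansion [CompleteSpace E] {f : X → E} (hf : ContDiffAt ℝ 4 f 0)
    {v w a b y : E → X} (hv : ContDiff ℝ 1 v) (hw : ContDiff ℝ 1 w) (ha : ContDiff ℝ 1 a)
    (hb : ContDiff ℝ 1 b) (hy : ContDiff ℝ 1 y) {Φ : E → E}
    (hLv : ∀ z, fderiv ℝ f 0 (v z) = 0) (hLw : ∀ z, fderiv ℝ f 0 (w z) = 0)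
    (hLa : ∀ z, fderiv ℝ f 0 (a z) = -((1 / 2 : ℝ) • fderiv ℝ (fderiv ℝ f) 0 (v z) (v z)))
    (hLb : ∀ z, fderiv ℝ f 0 (b z) = -((1 / 2 : ℝ) • (fderiv ℝ (fderiv ℝ f) 0 (v z) (w z) +
      fderiv ℝ (fderiv ℝ f) 0 (w z) (v z))))
    (hΦ : ∀ z, fderiv ℝ f 0 (y z) + (1 / 2 : ℝ) • (fderiv ℝ (fderiv ℝ f) 0 (v z) (a z) +
      fderiv ℝ (fderiv ℝ f) 0 (a z) (v z) + fderiv ℝ (fderiv ℝ f) 0 (w z) (w z)) +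
      (1 / 6 : ℝ) • fderiv ℝ (fderiv ℝ (fderiv ℝ f)) 0 (v z) (v z) (v z) = Φ z)
    (hΦ0 : Φ 0 = 0) (hΦ' : HasStrictFDerivAt Φ (ContinuousLinearMap.id ℝ E) 0) :
    IsOpenAt f 0 := by
  intro N hN
  set L := fderiv ℝ f 0
  set B := fderiv ℝ (fderiv ℝ f) 0
  set T := fderiv ℝ (fderiv ℝ (fderiv ℝ f)) 0
  -- The curve is ε²ξ. Since `ξ` and the tail `S` are C¹ jointly in (ε, z), their bounds and
  -- Lipschitz constants are uniform in small ε.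
  let ξ : ℝ × E → X := fun p =>
    v p.2 + p.1 • (w p.2 + p.1 • (a p.2 + p.1 • b p.2 + p.1 ^ 2 • y p.2))
  let S : ℝ × E → E := fun p => weightedTail B T p.1 (v p.2) (w p.2) (a p.2) (b p.2) (y p.2)
  have hξ : ContDiff ℝ 1 ξ := by fun_prop
  have hS : ContDiff ℝ 1 S := by
    unfold S weightedTail
    fun_prop
  obtain ⟨Kξ, s1, hs1, hLip1⟩ := hξ.contDiffAt.exists_lipschitzOnWith (x := ((0 : ℝ), (0 : E)))
  obtain ⟨KS, s2, hs2, hLip2⟩ := hS.contDiffAt.exists_lipschitzOnWith (x := ((0 : ℝ), (0 : E)))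
  -- The Lipschitz budget is 1/2: one quarter for `Φ`, one quarter for the terms made small by ε.
  obtain ⟨s3, hs3, happ⟩ := hΦ'.approximates_deriv_on_nhds (c := 1 / 4) (Or.inr (by norm_num))
  obtain ⟨Cξ, hCξ⟩ : ∃ C : ℝ, ∀ᶠ p in 𝓝 ((0 : ℝ), (0 : E)), ‖ξ p‖ ≤ C :=
    ⟨‖ξ (0, 0)‖ + 1, hξ.continuous.continuousAt.norm.eventually_le_const (by simp)⟩
  obtain ⟨CS, hCS⟩ : ∃ C : ℝ, ∀ᶠ p in 𝓝 ((0 : ℝ), (0 : E)), ‖S p‖ ≤ C :=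
    ⟨‖S (0, 0)‖ + 1, hS.continuous.continuousAt.norm.eventually_le_const (by simp)⟩
  obtain ⟨g', hg', hg'O⟩ := exists_fderiv_taylorRemainder hf
  obtain ⟨C, hC, δ, hδ, hR⟩ := exists_lipschitz_of_hasFDerivAt hg' hg'O
  have hxN : ∀ᶠ p in 𝓝 ((0 : ℝ), (0 : E)), p.1 ^ 2 • ξ p ∈ N := by
    have : ContinuousAt (fun p : ℝ × E => p.1 ^ 2 • ξ p) (0, 0) :=
      ((continuous_fst.pow 2).smul hξ.continuous).continuousAt
    exact this (by simpa using hN)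
  obtain ⟨r0, hr0, hall⟩ := Metric.eventually_nhds_iff.1 (((hxN.and hCξ).and hCS).and
    ((Filter.eventually_mem_set.2 hs1).and (Filter.eventually_mem_set.2 hs2)))
  obtain ⟨r1, hr1, hball1⟩ := Metric.mem_nhds_iff.1 hs3
  set r := min r0 r1 / 2 with hr
  have hrpos : 0 < r := by positivity
  have hrr0 : r < r0 := by have := min_le_left r0 r1; have := lt_min hr0 hr1; linarith
  have hrr1 : r < r1 := by have := min_le_right r0 r1; have := lt_min hr0 hr1; linarith
  have hCξ0 : 0 ≤ Cξ := (norm_nonneg _).trans (hall (y := (0, 0)) (by simpa using hr0)).1.1.2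
  have hCS0 : 0 ≤ CS := (norm_nonneg _).trans (hall (y := (0, 0)) (by simpa using hr0)).1.2
  -- the choice of `ε`
  obtain ⟨ε, hε0, hεr, hε1, hε2, hε3⟩ : ∃ ε : ℝ, 0 < ε ∧ ε < r0 ∧ ε ^ 2 * Cξ < δ ∧
      ε * KS + ε ^ 2 * (C * Cξ ^ 3 * Kξ) < 1 / 4 ∧
      ε * CS + ε ^ 2 * (C * Cξ ^ 3 * Cξ) < r / 4 := by
    have e1 : ∀ᶠ ε in 𝓝[>] (0 : ℝ), ε < r0 := nhdsWithin_le_nhds (eventually_lt_nhds hr0)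
    have lim : ∀ g : ℝ → ℝ, Continuous g → g 0 = 0 → ∀ c > 0, ∀ᶠ ε in 𝓝[>] (0 : ℝ), g ε < c :=
      fun g hg h0 c hc => nhdsWithin_le_nhds
        (hg.continuousAt.eventually_lt_const (by rw [h0]; exact hc))
    have e2 := lim (fun ε => ε ^ 2 * Cξ) (by fun_prop) (by simp) δ hδ
    have e3 := lim (fun ε => ε * KS + ε ^ 2 * (C * Cξ ^ 3 * Kξ)) (by fun_prop) (by simp) (1 / 4)
      (by norm_num)
    have e4 := lim (fun ε => ε * CS + ε ^ 2 * (C * Cξ ^ 3 * Cξ)) (by fun_prop) (by simp) (r / 4)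
      (by positivity)
    obtain ⟨ε, h0, h1, h2, h3, h4⟩ :=
      ((eventually_mem_nhdsWithin (a := (0 : ℝ)) (s := Set.Ioi 0)).and (e1.and (e2.and (e3.and e4)))).exists
    exact ⟨ε, h0, h1, h2, h3, h4⟩
  have hdist : ∀ z : E, ‖z‖ ≤ r → dist (ε, z) ((0 : ℝ), (0 : E)) < r0 := fun z hz => by
    rw [Prod.dist_eq, dist_zero_right, dist_zero_right, Real.norm_of_nonneg hε0.le]
    exact max_lt hεr (hz.trans_lt hrr0)
  let x : E → X := fun z => ε ^ 2 • ξ (ε, z)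
  have hxnorm : ∀ z : E, ‖z‖ ≤ r → ‖x z‖ ≤ ε ^ 2 * Cξ := fun z hz => by
    rw [norm_smul, norm_pow, Real.norm_of_nonneg hε0.le]
    gcongr
    exact (hall (hdist z hz)).1.1.2
  let G : E → E := fun z => (ε ^ 6)⁻¹ • (f (x z) - f 0)
  have hG : ∀ z, G z = Φ z + ε • S (ε, z) + (ε ^ 6)⁻¹ • taylorRemainder f (x z) := fun z => by
    have h1 := cubic_weighted_eq L B T ε (y := y z) (hLv z) (hLw z) (hLa z) (hLb z) (x := x z) rfl
    rw [hΦ z] at h1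
    have h2 : f (x z) - f 0 = ε ^ 6 • (Φ z + ε • S (ε, z)) + taylorRemainder f (x z) := by
      rw [← h1, taylorRemainder]
      abel
    change (ε ^ 6)⁻¹ • (f (x z) - f 0) = _
    rw [h2, smul_add, inv_smul_smul₀ (by positivity)]
  -- On the ball of radius ε²`Cξ` the remainder has Lipschitz constant C(ε²`Cξ`)³, and x = ε²ξ
  -- contributes another ε²; division by ε⁶ leaves ε².
  have hRlip : ∀ z z' : E, ‖z‖ ≤ r → ‖z'‖ ≤ r →
      ‖(ε ^ 6)⁻¹ • taylorRemainder f (x z) - (ε ^ 6)⁻¹ • taylorRemainder f (x z')‖ ≤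
        ε ^ 2 * (C * Cξ ^ 3) * ‖ξ (ε, z) - ξ (ε, z')‖ := fun z z' hz hz' => by
    have h1 := hR (ε ^ 2 * Cξ) hε1 (x z) (x z') (hxnorm z hz) (hxnorm z' hz')
    have h2 : ‖x z - x z'‖ = ε ^ 2 * ‖ξ (ε, z) - ξ (ε, z')‖ := by
      rw [← smul_sub, norm_smul, norm_pow, Real.norm_of_nonneg hε0.le]
    rw [← smul_sub, norm_smul, norm_inv, norm_pow, Real.norm_of_nonneg hε0.le]
    rw [h2] at h1
    rw [inv_mul_le_iff₀ (by positivity)]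
    refine h1.trans (le_of_eq ?_)
    ring
  have happrox : ApproximatesLinearOn G (ContinuousLinearMap.id ℝ E : E →L[ℝ] E)
      (Metric.closedBall 0 r) (1 / 2 : NNReal) := by
    intro z hz z' hz'
    rw [mem_closedBall_zero_iff] at hz hz'
    have a1 := happ z (hball1 (by simpa using hz.trans_lt hrr1)) z'
      (hball1 (by simpa using hz'.trans_lt hrr1))
    have d : dist (ε, z) (ε, z') = ‖z - z'‖ := by simp [dist_eq_norm]
    have a2 := hLip2.dist_le_mul _ (hall (hdist z hz)).2.2 _ (hall (hdist z' hz')).2.2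
    have a3 := hLip1.dist_le_mul _ (hall (hdist z hz)).2.1 _ (hall (hdist z' hz')).2.1
    rw [d, dist_eq_norm] at a2 a3
    have a4 := hRlip z z' hz hz'
    have a5 : ε ^ 2 * (C * Cξ ^ 3) * ‖ξ (ε, z) - ξ (ε, z')‖ ≤
        ε ^ 2 * (C * Cξ ^ 3) * (Kξ * ‖z - z'‖) := by gcongr
    have a6 : ‖ε • (S (ε, z) - S (ε, z'))‖ ≤ ε * (KS * ‖z - z'‖) := by
      rw [norm_smul, Real.norm_of_nonneg hε0.le]
      gcongr
    have key : G z - G z' - (ContinuousLinearMap.id ℝ E) (z - z') =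
        (Φ z - Φ z' - (ContinuousLinearMap.id ℝ E) (z - z')) + ε • (S (ε, z) - S (ε, z')) +
        ((ε ^ 6)⁻¹ • taylorRemainder f (x z) - (ε ^ 6)⁻¹ • taylorRemainder f (x z')) := by
      rw [hG, hG]
      module
    rw [key]
    refine (norm_add₃_le).trans ?_
    have a7 : (ε * KS + ε ^ 2 * (C * Cξ ^ 3 * Kξ)) * ‖z - z'‖ ≤ 1 / 4 * ‖z - z'‖ := by gcongr
    push_cast at a1 ⊢
    linarith
  -- The identity has a right inverse of norm 1, so the image contains the ball of radius (1 - 1/2)r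
  -- about `G 0`. This leaves r/4 for `G 0` and r/4 for the target.
  have hsurj := happrox.surjOn_closedBall_of_nonlinearRightInverse
    ⟨id, 1, fun u => by simp, fun u => rfl⟩ hrpos.le le_rfl
  have hG0 : ‖G 0‖ ≤ r / 4 := by
    have a1 : ‖ε • S (ε, 0)‖ ≤ ε * CS := by
      rw [norm_smul, Real.norm_of_nonneg hε0.le]
      gcongr
      exact (hall (hdist 0 (by simpa using hrpos.le))).1.2
    have h1 := hR (ε ^ 2 * Cξ) hε1 (x 0) 0 (hxnorm 0 (by simpa using hrpos.le))
      (by simpa using by positivity)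
    rw [taylorRemainder_zero, sub_zero, sub_zero] at h1
    have a2 : ‖(ε ^ 6)⁻¹ • taylorRemainder f (x 0)‖ ≤ ε ^ 2 * (C * Cξ ^ 3 * Cξ) := by
      rw [norm_smul, norm_inv, norm_pow, Real.norm_of_nonneg hε0.le,
        inv_mul_le_iff₀ (by positivity)]
      refine h1.trans ((mul_le_mul_of_nonneg_left (hxnorm 0 (by simpa using hrpos.le))
        (by positivity)).trans (le_of_eq ?_))
      ring
    rw [hG, hΦ0, zero_add]
    refine (norm_add_le _ _).trans ?_
    linarith
  refine Metric.mem_nhds_iff.2 ⟨ε ^ 6 * (r / 4), by positivity, fun e he => ?_⟩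
  obtain ⟨z, hz, hze⟩ : (ε ^ 6)⁻¹ • (e - f 0) ∈ G '' Metric.closedBall 0 r := by
    refine hsurj ?_
    have hn : ‖(ε ^ 6)⁻¹ • (e - f 0)‖ ≤ r / 4 := by
      rw [norm_smul, norm_inv, norm_pow, Real.norm_of_nonneg hε0.le,
        inv_mul_le_iff₀ (by positivity)]
      exact (mem_ball_iff_norm.1 he).le
    have hrad : r / 4 + r / 4 ≤ (((1 : NNReal) : ℝ)⁻¹ - ((1 / 2 : NNReal) : ℝ)) * r := by
      push_cast
      linarith
    rw [mem_closedBall_iff_norm]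
    exact (norm_sub_le _ _).trans ((add_le_add hn hG0).trans hrad)
  rw [mem_closedBall_zero_iff] at hz
  refine ⟨x z, (hall (hdist z hz)).1.1.1, ?_⟩
  have := smul_right_injective E (inv_ne_zero (pow_ne_zero 6 hε0.ne')) hze
  exact sub_left_injective this

end Weighted

/-! ### Regular zeros in arbitrary corank -/

section Criteria

variable {X E : Type*} [NormedAddCommGroup X] [NormedSpace ℝ X]
  [NormedAddCommGroup E] [NormedSpace ℝ E] [FiniteDimensional ℝ E]

/-- A continuous linear map to a finite-dimensional space has a continuous right inverse on its
range. -/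
theorem exists_rightInverse_on_range (L : X →L[ℝ] E) :
    ∃ R : E →L[ℝ] X, ∀ x, L (R (L x)) = L x := by
  obtain ⟨S, hS⟩ := L.toLinearMap.rangeRestrict.exists_rightInverse_of_surjective
    (LinearMap.range_rangeRestrict _)
  obtain ⟨R, hR⟩ := S.exists_extend
  refine ⟨R.toContinuousLinearMap, fun x => ?_⟩
  have h1 : R (L x) = S ⟨L x, x, rfl⟩ :=
    LinearMap.congr_fun hR (⟨L x, x, rfl⟩ : L.toLinearMap.range)
  have h2 := congrArg Subtype.val (LinearMap.congr_fun hS ⟨L x, x, rfl⟩)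
  change L (R (L x)) = L x
  rw [h1]
  exact h2

/-- Third order sufficient condition for openness at a critical point of arbitrary corank. -/
theorem isOpenAt_of_regularZero {f : X → E} (hf : ContDiffAt ℝ 4 f 0) {v₀ w₀ : X}
    (hw₀ : fderiv ℝ f 0 w₀ = 0)
    (hBw₀ : fderiv ℝ (fderiv ℝ f) 0 w₀ w₀ ∈ (fderiv ℝ f 0).toLinearMap.range)
    (hv₀ : fderiv ℝ f 0 v₀ = 0)
    (hBv₀ : ∀ x, fderiv ℝ (fderiv ℝ f) 0 v₀ x ∈ (fderiv ℝ f 0).toLinearMap.range)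
    (hTv₀ : fderiv ℝ (fderiv ℝ (fderiv ℝ f)) 0 v₀ v₀ v₀ ∈ (fderiv ℝ f 0).toLinearMap.range)
    (hreg : ∀ e : E, ∃ u w p : X, fderiv ℝ f 0 w = 0 ∧ fderiv ℝ f 0 p = 0 ∧
      (∀ x, fderiv ℝ (fderiv ℝ f) 0 p x ∈ (fderiv ℝ f 0).toLinearMap.range) ∧
      e = fderiv ℝ f 0 u + fderiv ℝ (fderiv ℝ f) 0 w₀ w +
        fderiv ℝ (fderiv ℝ (fderiv ℝ f)) 0 v₀ v₀ p) :
    IsOpenAt f 0 := by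
  have : CompleteSpace E := FiniteDimensional.complete ℝ E
  have hBs : ∀ u v, fderiv ℝ (fderiv ℝ f) 0 u v = fderiv ℝ (fderiv ℝ f) 0 v u :=
    (hf.isSymmSndFDerivAt (by simp; norm_num))
  have hTl := third_fderiv_symm_left hf
  have hTr := third_fderiv_symm_right hf
  set L := fderiv ℝ f 0 with hL
  set B := fderiv ℝ (fderiv ℝ f) 0 with hB
  set T := fderiv ℝ (fderiv ℝ (fderiv ℝ f)) 0 with hT
  obtain ⟨R, hR⟩ := exists_rightInverse_on_range L
  have hR' : ∀ e ∈ L.toLinearMap.range, L (R e) = e := by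
    rintro _ ⟨x, rfl⟩
    exact hR x
  -- a linear right inverse of `(u, w, p) ↦ L u + B(w₀, w) + T(v₀, v₀, p) / 2`
  let K : Submodule ℝ X := L.toLinearMap.ker
  let D : Submodule ℝ X := K ⊓ ⨅ x, (L.toLinearMap.range).comap (B.flip x).toLinearMap
  have hD : ∀ p, p ∈ D ↔ L p = 0 ∧ ∀ x, B p x ∈ L.toLinearMap.range := fun p => by
    simp [D, K, Submodule.mem_inf, Submodule.mem_iInf]
  -- The factor 1/2 comes from differentiating T(v, v, v)/6 at `v₀`; it is compensated by doubling
  -- `p` in the proof of surjectivity.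
  let Λ : (X × K × D) →ₗ[ℝ] E :=
    L.toLinearMap.coprod (((B w₀).toLinearMap ∘ₗ K.subtype).coprod
      ((1 / 2 : ℝ) • ((T v₀ v₀).toLinearMap ∘ₗ D.subtype)))
  have hΛ : Function.Surjective Λ := fun e => by
    obtain ⟨u, w, p, hw, hp, hp', rfl⟩ := hreg e
    refine ⟨(u, ⟨w, hw⟩, (2 : ℝ) • ⟨p, (hD p).2 ⟨hp, hp'⟩⟩), ?_⟩
    simp [Λ, add_assoc]
  obtain ⟨A, hA⟩ := Λ.exists_rightInverse_of_surjective (LinearMap.range_eq_top.2 hΛ)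
  let Y : E →L[ℝ] X := (LinearMap.fst ℝ X (K × D) ∘ₗ A).toContinuousLinearMap
  let W : E →L[ℝ] X :=
    (K.subtype ∘ₗ LinearMap.fst ℝ K D ∘ₗ LinearMap.snd ℝ X (K × D) ∘ₗ A).toContinuousLinearMap
  let P : E →L[ℝ] X :=
    (D.subtype ∘ₗ LinearMap.snd ℝ K D ∘ₗ LinearMap.snd ℝ X (K × D) ∘ₗ A).toContinuousLinearMap
  have hA' : ∀ z, L (Y z) + B w₀ (W z) + (1 / 2 : ℝ) • T v₀ v₀ (P z) = z := fun z => by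
    have := LinearMap.congr_fun hA z
    rw [add_assoc]
    exact this
  have hW : ∀ z, L (W z) = 0 := fun z => (A z).2.1.2
  have hP : ∀ z, L (P z) = 0 ∧ ∀ x, B (P z) x ∈ L.toLinearMap.range := fun z =>
    (hD _).1 (A z).2.2.2
  -- `y₀` removes the constant term of the sixth order coefficient; this uses that `w₀` is isotropic
  -- and `v₀` a zero of the cubic form.
  obtain ⟨y₀, hy₀⟩ : ∃ y₀, L y₀ = -((1 / 2 : ℝ) • B w₀ w₀ + (1 / 6 : ℝ) • T v₀ v₀ v₀) :=
    Submodule.neg_mem _ (Submodule.add_mem _ (Submodule.smul_mem _ _ hBw₀)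
      (Submodule.smul_mem _ _ hTv₀))
  let v : E → X := fun z => v₀ + P z
  let w : E → X := fun z => w₀ + W z
  -- `a` and `b` solve the equations of orders four and five, and the last term of `y` cancels B(v,
  -- a). All use that B(v z, ·) stays in the range of `L`.
  let a : E → X := fun z => -((1 / 2 : ℝ) • R (B (v z) (v z)))
  let b : E → X := fun z => -R (B (v z) (w z))
  let y : E → X := fun z => y₀ + Y z - R (B (v z) (a z))
  have hBv : ∀ z x, B (v z) x ∈ L.toLinearMap.range := fun z x => by
    change B (v₀ + P z) x ∈ _
    rw [map_add, add_apply]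
    exact Submodule.add_mem _ (hBv₀ x) ((hP z).2 x)
  -- The constant terms cancel and `A` turns the linear ones into `z`; the rest is quadratic and
  -- cubic in `z`.
  let Φ : E → E := fun z => z + ((1 / 2 : ℝ) • B (W z) (W z) +
    (1 / 2 : ℝ) • T (P z) (P z) v₀ + (1 / 6 : ℝ) • T (P z) (P z) (P z))
  refine isOpenAt_of_weighted_expansion hf (v := v) (w := w) (a := a) (b := b) (y := y) (Φ := Φ)
    (by fun_prop) (by fun_prop) (by fun_prop) (by fun_prop) (by fun_prop) (fun z => ?_)
    (fun z => ?_) (fun z => ?_) (fun z => ?_) (fun z => ?_) (by simp [Φ]) ?_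
  · change L (v₀ + P z) = 0
    rw [map_add, hv₀, (hP z).1, add_zero]
  · change L (w₀ + W z) = 0
    rw [map_add, hw₀, hW, add_zero]
  · change L (-((1 / 2 : ℝ) • R (B (v z) (v z)))) = _
    rw [map_neg, map_smul, hR' _ (hBv z _)]
  · change L (-R (B (v z) (w z))) = -((1 / 2 : ℝ) • (B (v z) (w z) + B (w z) (v z)))
    rw [map_neg, hR' _ (hBv z _), hBs (w z)]
    module
  · change L (y₀ + Y z - R (B (v z) (a z))) + (1 / 2 : ℝ) • (B (v z) (a z) + B (a z) (v z) +
      B (w z) (w z)) + (1 / 6 : ℝ) • T (v z) (v z) (v z) = Φ z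
    rw [map_sub, hR' _ (hBv z _), map_add, hy₀, hBs (a z)]
    have h1 : L (Y z) = z - B w₀ (W z) - (1 / 2 : ℝ) • T v₀ v₀ (P z) := by
      nth_rw 2 [← hA' z]
      abel
    rw [h1]
    simp only [v, w, Φ, map_add, add_apply]
    rw [hBs (W z) w₀, hTl (P z) v₀, hTr v₀ (P z) v₀, hTr (P z) (P z) v₀, hTl (P z) v₀]
    module
  · have hsmooth : ContDiff ℝ 1 Φ := by fun_prop
    refine (hsmooth.contDiffAt.hasStrictFDerivAt one_ne_zero).congr_fderiv ?_
    refine HasFDerivAt.fderiv ?_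
    have hPd : HasFDerivAt (fun z => P z) P (0 : E) := P.hasFDerivAt
    have hWd : HasFDerivAt (fun z => W z) W (0 : E) := W.hasFDerivAt
    have h1 := (((B.hasFDerivAt.comp (0 : E) hWd).clm_apply hWd).const_smul (1 / 2 : ℝ)).add
      ((((T.hasFDerivAt.comp (0 : E) hPd).clm_apply hPd).clm_apply
        (hasFDerivAt_const v₀ (0 : E))).const_smul (1 / 2 : ℝ))
    have h2 := h1.add ((((T.hasFDerivAt.comp (0 : E) hPd).clm_apply hPd).clm_apply
        hPd).const_smul (1 / 6 : ℝ))
    refine ((hasFDerivAt_id (0 : E)).add h2).congr_fderiv ?_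
    ext z
    simp

end Criteria

/-! ### Lyapunov–Schmidt reduction in corank one -/

section CorankOne

variable {X E : Type*} [NormedAddCommGroup X] [NormedSpace ℝ X]
  [NormedAddCommGroup E] [NormedSpace ℝ E]

theorem isBigO_clm_apply {α : Type*} {l : Filter α} {A : α → X →L[ℝ] E} {u : α → X}
    {a b : α → ℝ} (hA : A =O[l] a) (hu : u =O[l] b) :
    (fun t => A t (u t)) =O[l] fun t => a t * b t :=
  (Asymptotics.IsBigO.of_norm_le fun t => (A t).le_opNorm (u t)).trans (hA.norm_left.mul hu.norm_left)

theorem isBigO_clm_comp {α : Type*} {l : Filter α} (A : X →L[ℝ] E) {u : α → X}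
    {b : α → ℝ} (hu : u =O[l] b) : (fun t => A (u t)) =O[l] b :=
  (A.isBigO_comp u l).trans hu

variable {f : X → E}

theorem taylorRemainder_isBigO (hf : ContDiffAt ℝ 4 f 0) :
    taylorRemainder f =O[𝓝 0] fun x => ‖x‖ ^ 4 := by
  obtain ⟨g', h, hO⟩ := exists_fderiv_taylorRemainder hf
  exact isBigO_of_hasFDerivAt h taylorRemainder_zero hO

/-- The error of the first order expansion is of second order along curves. -/
theorem sub_fderiv_isBigO (hf : ContDiffAt ℝ 4 f 0) {x : ℝ → X}
    (hx : x =O[𝓝 0] fun t : ℝ => t) (hx0 : Filter.Tendsto x (𝓝 0) (𝓝 0)) :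
    (fun t => f (x t) - f 0 - fderiv ℝ f 0 (x t)) =O[𝓝 0] fun t : ℝ => t ^ 2 := by
  set B := fderiv ℝ (fderiv ℝ f) 0 with hB
  set T := fderiv ℝ (fderiv ℝ (fderiv ℝ f)) 0 with hT
  have pow_le : ∀ k ≥ 2, (fun t : ℝ => t ^ k) =O[𝓝 0] fun t : ℝ => t ^ 2 := fun k hk =>
    (Asymptotics.isBigO_refl (fun t : ℝ => t ^ 2) (𝓝 0)).mul
      (((continuous_pow (k - 2)).tendsto (0 : ℝ)).isBigO_one ℝ) |>.congr
        (fun t => by rw [← pow_add, Nat.add_sub_cancel' hk]) (fun t => mul_one _)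
  have h1 : (fun t => B (x t) (x t)) =O[𝓝 0] fun t : ℝ => t ^ 2 :=
    (isBigO_clm_apply (isBigO_clm_comp B hx) hx).congr_right fun t => by ring
  have h2 : (fun t => T (x t) (x t) (x t)) =O[𝓝 0] fun t : ℝ => t ^ 3 :=
    (isBigO_clm_apply (isBigO_clm_apply (isBigO_clm_comp T hx) hx) hx).congr_right
      fun t => by ring
  have h3 : (fun t => taylorRemainder f (x t)) =O[𝓝 0] fun t : ℝ => t ^ 4 :=
    ((taylorRemainder_isBigO hf).comp_tendsto hx0).trans (hx.norm_left.pow 4)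
  refine (((h1.const_smul_left (1 / 2 : ℝ)).add ((h2.trans (pow_le 3 (by norm_num))).const_smul_left
    (1 / 6 : ℝ))).add (h3.trans (pow_le 4 (by norm_num)))).congr_left fun t => ?_
  simp only [taylorRemainder, Pi.smul_apply]
  abel

/-- Along a curve `t v + O(t²)` with `v` in the domain of the third differential, a functional
vanishing on the image of the differential sees only the cubic term. -/
theorem functional_sub_cubic_isBigO (hf : ContDiffAt ℝ 4 f 0) {v : X} {r : ℝ → X}
    (hr : r =O[𝓝 0] fun t : ℝ => t ^ 2) (φ : E →L[ℝ] ℝ)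
    (hL : ∀ u, φ (fderiv ℝ f 0 u) = 0) (hB : ∀ u, φ (fderiv ℝ (fderiv ℝ f) 0 v u) = 0) :
    (fun t : ℝ => φ (f (t • v + r t) - f 0) -
      t ^ 3 * φ ((1 / 6 : ℝ) • fderiv ℝ (fderiv ℝ (fderiv ℝ f)) 0 v v v)) =O[𝓝 0]
      fun t : ℝ => t ^ 4 := by
  have hBs : ∀ u w, fderiv ℝ (fderiv ℝ f) 0 u w = fderiv ℝ (fderiv ℝ f) 0 w u :=
    (hf.isSymmSndFDerivAt (by simp; norm_num))
  have hB' : ∀ u, φ (fderiv ℝ (fderiv ℝ f) 0 u v) = 0 := fun u => by rw [hBs, hB]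
  set B := fderiv ℝ (fderiv ℝ f) 0 with hBdef
  set T := fderiv ℝ (fderiv ℝ (fderiv ℝ f)) 0 with hTdef
  have hv : (fun t : ℝ => t • v) =O[𝓝 0] fun t : ℝ => t :=
    Asymptotics.IsBigO.of_bound ‖v‖ (.of_forall fun t => by rw [norm_smul, mul_comm])
  have hrt : r =O[𝓝 0] fun t : ℝ => t := by
    refine hr.trans (Asymptotics.IsBigO.of_bound 1 ?_)
    filter_upwards [Metric.ball_mem_nhds (0 : ℝ) one_pos] with t ht
    rw [norm_pow, one_mul, sq]
    exact mul_le_of_le_one_left (norm_nonneg _) (mem_ball_zero_iff.1 ht).le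
  have hx : (fun t : ℝ => t • v + r t) =O[𝓝 0] fun t : ℝ => t := hv.add hrt
  have hx0 : Filter.Tendsto (fun t : ℝ => t • v + r t) (𝓝 0) (𝓝 0) :=
    hx.trans_tendsto Filter.tendsto_id
  -- `φ` kills B(v, ·) and B(·, v), so of the quadratic term only B(r, r) survives. The next three
  -- bounds telescope T(x, x, x) - T(tv, tv, tv), replacing one argument at a time.
  have h1 : (fun t => B (r t) (r t)) =O[𝓝 0] fun t : ℝ => t ^ 4 :=
    (isBigO_clm_apply (isBigO_clm_comp B hr) hr).congr_right fun t => by ring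
  have h2 : (fun t => T (r t) (t • v + r t) (t • v + r t)) =O[𝓝 0] fun t : ℝ => t ^ 4 :=
    (isBigO_clm_apply (isBigO_clm_apply (isBigO_clm_comp T hr) hx) hx).congr_right
      fun t => by ring
  have h3 : (fun t : ℝ => T (t • v) (r t) (t • v + r t)) =O[𝓝 0] fun t : ℝ => t ^ 4 :=
    (isBigO_clm_apply (isBigO_clm_apply (isBigO_clm_comp T hv) hr) hx).congr_right
      fun t => by ring
  have h4 : (fun t : ℝ => T (t • v) (t • v) (r t)) =O[𝓝 0] fun t : ℝ => t ^ 4 :=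
    (isBigO_clm_apply (isBigO_clm_apply (isBigO_clm_comp T hv) hv) hr).congr_right
      fun t => by ring
  have h5 : (fun t => taylorRemainder f (t • v + r t)) =O[𝓝 0] fun t : ℝ => t ^ 4 :=
    ((taylorRemainder_isBigO hf).comp_tendsto hx0).trans (hx.norm_left.pow 4)
  refine (isBigO_clm_comp φ (((h1.const_smul_left (1 / 2 : ℝ)).add
    (((h2.add h3).add h4).const_smul_left (1 / 6 : ℝ))).add h5)).congr_left fun t => ?_
  have e1 : f (t • v + r t) - f 0 = fderiv ℝ f 0 (t • v + r t) +
      (1 / 2 : ℝ) • B (t • v + r t) (t • v + r t) +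
      (1 / 6 : ℝ) • T (t • v + r t) (t • v + r t) (t • v + r t) +
      taylorRemainder f (t • v + r t) := by
    simp only [taylorRemainder]
    abel
  rw [e1]
  simp only [map_add, map_smul, add_apply, smul_apply, hL, hB, hB', Pi.smul_apply, smul_eq_mul]
  ring

/-- Third order sufficient condition for openness at a critical point of corank one. -/
theorem isOpenAt_of_third_ne_zero [FiniteDimensional ℝ E] (hf : ContDiffAt ℝ 4 f 0)
    (φ : E →L[ℝ] ℝ) (hφ : ∀ e, φ e = 0 ↔ e ∈ (fderiv ℝ f 0).toLinearMap.range) {v : X}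
    (hv : fderiv ℝ f 0 v = 0)
    (hBv : ∀ x, fderiv ℝ (fderiv ℝ f) 0 v x ∈ (fderiv ℝ f 0).toLinearMap.range)
    (hTv : 0 < φ (fderiv ℝ (fderiv ℝ (fderiv ℝ f)) 0 v v v)) :
    IsOpenAt f 0 := by
  intro N hN
  obtain ⟨R, hR⟩ := exists_rightInverse_on_range (fderiv ℝ f 0)
  have hfs : HasStrictFDerivAt f (fderiv ℝ f 0) 0 := hf.hasStrictFDerivAt (by norm_num)
  set L := fderiv ℝ f 0 with hLdef
  let E₁ : Submodule ℝ E := L.toLinearMap.range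
  have hR' : ∀ e ∈ E₁, L (R e) = e := by
    rintro _ ⟨x, rfl⟩
    exact hR x
  -- `Q` is a projection onto the range `E₁` of `L`; since ker φ = `E₁`, the pair (Q, φ) is
  -- injective on `E`.
  let Q : E →L[ℝ] E₁ := (L ∘L R).codRestrict E₁ fun e => ⟨R e, rfl⟩
  have hQ : ∀ q : E₁, Q q = q := fun q => Subtype.ext (hR' q q.2)
  have hQφ : ∀ e, Q e = 0 → φ e = 0 → e = 0 := fun e h1 h2 => by
    rw [← hR' e ((hφ e).1 h2)]
    exact congrArg Subtype.val h1
  let ℓ : ℝ × E₁ →L[ℝ] X :=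
    (ContinuousLinearMap.fst ℝ ℝ E₁).smulRight v + (R ∘L E₁.subtypeL) ∘L ContinuousLinearMap.snd ℝ ℝ E₁
  have hℓ : ∀ p, ℓ p = p.1 • v + R p.2 := fun p => rfl
  -- The derivative of `Ψ` at 0 is the identity because Lv = 0 and LR = id on `E₁`. Its local
  -- inverse yields x(t, q) with Q(f(x) - f(0)) = q, leaving only the scalar equation for `H`.
  let Ψ : ℝ × E₁ → ℝ × E₁ := fun p => (p.1, Q (f (ℓ p) - f 0))
  have hΨ0 : Ψ 0 = 0 := by simp [Ψ]
  have hΨ : HasStrictFDerivAt Ψ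
      (ContinuousLinearEquiv.refl ℝ (ℝ × E₁) : (ℝ × E₁) →L[ℝ] (ℝ × E₁)) 0 := by
    have h1 : HasStrictFDerivAt f L (ℓ 0) := by rwa [map_zero]
    have h2 := Q.hasStrictFDerivAt.comp (0 : ℝ × E₁)
      ((h1.comp (0 : ℝ × E₁) ℓ.hasStrictFDerivAt).sub_const (f 0))
    refine (hasStrictFDerivAt_fst.prodMk h2).congr_fderiv ?_
    refine ContinuousLinearMap.ext fun p => Prod.ext rfl ?_
    change Q (L (ℓ p)) = p.2
    rw [hℓ, map_add, map_smul, hv, smul_zero, zero_add, hR' _ p.2.2, hQ]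
  set Θ := hΨ.toOpenPartialHomeomorph Ψ with hΘ
  have hΘ0 : (0 : ℝ × E₁) ∈ Θ.target := by
    have := hΨ.image_mem_toOpenPartialHomeomorph_target
    rwa [hΨ0] at this
  have hg0 : Θ.symm 0 = 0 := by
    have := hΨ.localInverse_apply_image
    rwa [hΨ0] at this
  have hgd : HasStrictFDerivAt Θ.symm
      ((ContinuousLinearEquiv.refl ℝ (ℝ × E₁)).symm : (ℝ × E₁) →L[ℝ] (ℝ × E₁)) 0 := by
    have := hΨ.to_localInverse
    rwa [hΨ0] at this
  have hΘs : ∀ p ∈ Θ.target, Ψ (Θ.symm p) = p := fun p hp => Θ.right_inv hp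
  let x : ℝ × E₁ → X := fun p => ℓ (Θ.symm p)
  have hxc : ContinuousAt x 0 := ℓ.continuous.continuousAt.comp hgd.continuousAt
  have hx0 : x 0 = 0 := by simp [x, hg0]
  let H : ℝ × E₁ → ℝ := fun p => φ (f (x p) - f 0)
  obtain ⟨ρ, hρ, hball⟩ : ∃ ρ > 0, ∀ p : ℝ × E₁, dist p 0 < ρ →
      p ∈ Θ.target ∧ x p ∈ N ∧ ContinuousAt H p := by
    refine Metric.eventually_nhds_iff.1 ?_
    have hfc : ∀ᶠ u in 𝓝 (0 : X), ContinuousAt f u := by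
      filter_upwards [hf.eventually (by simp)] with u hu using hu.continuousAt
    have hx0' : Filter.Tendsto x (𝓝 0) (𝓝 0) := by simpa [ContinuousAt, hx0] using hxc
    filter_upwards [Θ.open_target.mem_nhds hΘ0, hx0' hN, hx0' hfc] with p h1 h2 h3
    refine ⟨h1, h2, φ.continuous.continuousAt.comp (ContinuousAt.sub ?_ continuousAt_const)⟩
    exact ContinuousAt.comp h3 (ℓ.continuous.continuousAt.comp (Θ.symm.continuousAt h1))
  -- the reduced function has the sign of `t` along the axis
  obtain ⟨t₀, ht₀, ht₀ρ, hpos, hneg⟩ : ∃ t₀ : ℝ, 0 < t₀ ∧ t₀ < ρ ∧ 0 < H (t₀, 0) ∧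
      H (-t₀, 0) < 0 := by
    have hlim : Filter.Tendsto (fun t : ℝ => (t, (0 : E₁))) (𝓝 0) (𝓝 0) :=
      Continuous.tendsto' (by fun_prop) _ _ rfl
    have hxaxis : (fun t : ℝ => x (t, 0)) =O[𝓝 0] fun t : ℝ => t := by
      have h1 : (fun p => Θ.symm p) =O[𝓝 0] fun p : ℝ × E₁ => p := by
        simpa [hg0] using hgd.hasFDerivAt.isBigO_sub
      refine ((isBigO_clm_comp ℓ (h1.comp_tendsto hlim).norm_right)).trans ?_
      exact Asymptotics.IsBigO.of_bound 1 (.of_forall fun t => by simp [Prod.norm_def])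
    have hxt : Filter.Tendsto (fun t : ℝ => x (t, 0)) (𝓝 0) (𝓝 0) :=
      hxaxis.trans_tendsto Filter.tendsto_id
    have hform : ∀ᶠ t : ℝ in 𝓝 0, x (t, 0) = t • v + R (Θ.symm (t, 0)).2 ∧
        Q (f (x (t, 0)) - f 0) = 0 := by
      filter_upwards [hlim (Θ.open_target.mem_nhds hΘ0)] with t ht
      have h1 := hΘs _ ht
      have h2 : (Θ.symm (t, 0)).1 = t := congrArg Prod.fst h1
      refine ⟨?_, congrArg Prod.snd h1⟩
      change ℓ (Θ.symm (t, 0)) = _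
      rw [hℓ, h2]
    -- On the axis Q(f(x) - f(0)) = 0, while L(x) is the `E₁` component of the inverse; hence that
    -- component is -Q of the second order error f(x) - f(0) - L(x).
    have hy : (fun t : ℝ => R (Θ.symm (t, 0)).2) =O[𝓝 0] fun t : ℝ => t ^ 2 := by
      have h1 := isBigO_clm_comp ((R ∘L E₁.subtypeL) ∘L Q) (sub_fderiv_isBigO hf hxaxis hxt)
      refine h1.neg_left.congr' ?_ .rfl
      filter_upwards [hform] with t ht
      have h2 : L (x (t, 0)) = (Θ.symm (t, 0)).2 := by
        rw [ht.1, map_add, map_smul, hv, smul_zero, zero_add, hR' _ (Θ.symm (t, 0)).2.2]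
      change -(R (Q (f (x (t, 0)) - f 0 - L (x (t, 0))))) = _
      rw [map_sub, ht.2, h2, hQ, zero_sub]
      simp
    have hH := functional_sub_cubic_isBigO hf (v := v) hy φ (fun u => (hφ _).2 ⟨u, rfl⟩)
      (fun u => (hφ _).2 (hBv u))
    set c := φ ((1 / 6 : ℝ) • fderiv ℝ (fderiv ℝ (fderiv ℝ f)) 0 v v v) with hc
    have hcpos : 0 < c := by
      rw [hc, map_smul, smul_eq_mul]
      positivity
    have hlo : (fun t : ℝ => H (t, 0) - t ^ 3 * c) =o[𝓝 0] fun t : ℝ => t ^ 3 := by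
      refine Asymptotics.IsBigO.trans_isLittleO (hH.congr' ?_ .rfl)
        (Asymptotics.isLittleO_pow_pow (by norm_num : 3 < 4))
      filter_upwards [hform] with t ht
      change _ = φ (f (x (t, 0)) - f 0) - _
      rw [ht.1]
    obtain ⟨δ, hδ, hb⟩ := Metric.eventually_nhds_iff.1 (hlo.def (half_pos hcpos))
    set t₀ := min δ ρ / 2
    have hmin : 0 < min δ ρ := lt_min hδ hρ
    have ht₀ : 0 < t₀ := half_pos hmin
    have hlt : t₀ < min δ ρ := half_lt_self hmin
    refine ⟨t₀, ht₀, hlt.trans_le (min_le_right _ _), ?_, ?_⟩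
    · have h1 := hb (y := t₀) (by
        simpa [abs_of_pos ht₀] using hlt.trans_le (min_le_left _ _))
      rw [Real.norm_eq_abs, Real.norm_eq_abs, abs_of_pos (a := t₀ ^ 3) (by positivity)] at h1
      have h2 := (abs_le.1 h1).1
      have h3 : 0 < t₀ ^ 3 * c := by positivity
      linarith
    · have h1 := hb (y := -t₀) (by
        simpa [abs_of_pos ht₀] using hlt.trans_le (min_le_left _ _))
      have h4 : (-t₀) ^ 3 = -t₀ ^ 3 := by ring
      rw [h4, Real.norm_eq_abs, Real.norm_eq_abs, abs_neg,
        abs_of_pos (a := t₀ ^ 3) (by positivity)] at h1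
      have h2 := (abs_le.1 h1).2
      have h3 : 0 < t₀ ^ 3 * c := by positivity
      linarith
  have hdist : ∀ (t : ℝ) (q : E₁), |t| < ρ → ‖q‖ < ρ → dist (t, q) 0 < ρ := fun t q h1 h2 => by
    rw [dist_zero_right, Prod.norm_def]
    exact max_lt h1 h2
  have hQlim : Filter.Tendsto (fun e => Q (e - f 0)) (𝓝 (f 0)) (𝓝 0) :=
    Continuous.tendsto' (by fun_prop) _ _ (by simp)
  have hφlim : Filter.Tendsto (fun e => φ (e - f 0)) (𝓝 (f 0)) (𝓝 0) :=
    Continuous.tendsto' (by fun_prop) _ _ (by simp)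
  have hHlim : ∀ t : ℝ, |t| < ρ →
      Filter.Tendsto (fun e => H (t, Q (e - f 0))) (𝓝 (f 0)) (𝓝 (H (t, 0))) := fun t ht =>
    (hball (t, 0) (hdist t 0 ht (by simpa using hρ))).2.2.tendsto.comp
      (tendsto_const_nhds.prodMk_nhds hQlim)
  -- For `e` near `f 0`, φ(e - f(0)) stays strictly between H(-t₀, q) and H(t₀, q) with q = Q(e -
  -- f(0)), so a suitable t exists in [-t₀, t₀].
  filter_upwards [hQlim (Metric.ball_mem_nhds 0 hρ),
    hφlim.eventually_lt (hHlim t₀ (by rwa [abs_of_pos ht₀])) hpos,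
    (hHlim (-t₀) (by rwa [abs_neg, abs_of_pos ht₀])).eventually_lt hφlim hneg] with e h1 h2 h3
  have h1' : ‖Q (e - f 0)‖ < ρ := by simpa using h1
  have hin : ∀ t ∈ Set.Icc (-t₀) t₀, dist (t, Q (e - f 0)) 0 < ρ := fun t ht =>
    hdist t _ ((abs_le.2 ht).trans_lt ht₀ρ) h1'
  have hcont : ContinuousOn (fun t => H (t, Q (e - f 0))) (Set.Icc (-t₀) t₀) := fun t ht =>
    (ContinuousAt.comp (f := fun t : ℝ => (t, Q (e - f 0))) (hball _ (hin t ht)).2.2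
      (by fun_prop)).continuousWithinAt
  obtain ⟨t, ht, hte⟩ := intermediate_value_Icc (by linarith) hcont ⟨h3.le, h2.le⟩
  obtain ⟨hm, hmN, -⟩ := hball _ (hin t ht)
  refine ⟨x (t, Q (e - f 0)), hmN, ?_⟩
  have hq : Q (f (x (t, Q (e - f 0))) - f 0) = Q (e - f 0) := congrArg Prod.snd (hΘs _ hm)
  refine sub_left_injective (b := f 0) (sub_eq_zero.1 (hQφ _ ?_ ?_))
  · rw [map_sub, hq, sub_self]
  · rw [map_sub]
    exact sub_eq_zero.2 hte

end CorankOne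

/-! ### Passage from the manifold to a chart -/

section Chart

/-- Shrinking the neighbourhood so that `F` maps it into the source of `e` lets injectivity of `e`
pull solutions back to `M`. -/
theorem isOpenAt_of_chart {X M H : Type*} [TopologicalSpace X] [Zero X] [TopologicalSpace M]
    [TopologicalSpace H] {F : X → M} (hF : ContinuousAt F 0)
    (e : OpenPartialHomeomorph M H) (heF : F 0 ∈ e.source)
    (h : IsOpenAt (fun u => e (F u)) 0) : IsOpenAt F 0 := by
  intro N hN
  have h1 := h (N ∩ F ⁻¹' e.source)
    (Filter.inter_mem hN (hF.preimage_mem_nhds (e.open_source.mem_nhds heF)))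
  filter_upwards [e.continuousAt heF h1, e.open_source.mem_nhds heF] with y hy hys
  obtain ⟨u, ⟨hu, hus⟩, huy⟩ := hy
  exact ⟨u, hu, e.injOn hus hys huy⟩

variable {X : Type*} [NormedAddCommGroup X] [NormedSpace ℝ X]
  {m : ℕ} {M : Type*} [TopologicalSpace M] [ChartedSpace (EuclideanSpace ℝ (Fin m)) M]

/-- The chart identifies the tangent space with `ℝᵐ`, and `d₀F` with the derivative of the
representative of `F`. -/
theorem ofChart_spec {F : X → M} (hF : MDifferentiableAt 𝓘(ℝ, X) (𝓡 m) F 0)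
    {e : OpenPartialHomeomorph M (EuclideanSpace ℝ (Fin m))}
    (he : e ∈ IsManifold.maximalAtlas (𝓡 m) ∞ M) (heF : F 0 ∈ e.source) :
    Function.Bijective (ofChart e F) ∧
      ∀ u, ofChart e F (fderiv ℝ (fun u => e (F u)) 0 u) = diff m F u := by
  have he1 : MDifferentiableAt (𝓡 m) 𝓘(ℝ, EuclideanSpace ℝ (Fin m)) e (F 0) :=
    (contMDiffAt_of_mem_maximalAtlas he heF).mdifferentiableAt (by simp)
  have hmd : e.MDifferentiable (𝓡 m) 𝓘(ℝ, EuclideanSpace ℝ (Fin m)) :=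
    ⟨fun x hx => ((contMDiffAt_of_mem_maximalAtlas he hx).mdifferentiableAt
        (by simp)).mdifferentiableWithinAt,
      fun x hx => ((contMDiffAt_symm_of_mem_maximalAtlas he hx).mdifferentiableAt
        (by simp)).mdifferentiableWithinAt⟩
  let J : TangentSpace (𝓡 m) (F 0) ≃L[ℝ] EuclideanSpace ℝ (Fin m) := hmd.mfderiv heF
  -- `ContinuousLinearMap.inverse` takes the default value 0 on non-invertible maps; here the
  -- differential of the chart is an isomorphism, so it is the true inverse.
  have hJ : ofChart e F = J.symm :=
    ContinuousLinearMap.inverse_equiv J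
  refine ⟨by rw [hJ]; exact J.symm.bijective, fun u => ?_⟩
  have hcomp : fderiv ℝ (fun u => e (F u)) 0 u = J (diff m F u) := by
    have := mfderiv_comp (0 : X) he1 hF
    rw [mfderiv_eq_fderiv] at this
    exact congrArg (fun A => A u) this
  rw [hcomp, hJ]
  exact J.symm_apply_apply _

theorem proj_eq_zero_iff {F : X → M} (hF : MDifferentiableAt 𝓘(ℝ, X) (𝓡 m) F 0)
    {e : OpenPartialHomeomorph M (EuclideanSpace ℝ (Fin m))}
    (he : e ∈ IsManifold.maximalAtlas (𝓡 m) ∞ M) (heF : F 0 ∈ e.source)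
    (y : EuclideanSpace ℝ (Fin m)) :
    proj e F y = 0 ↔ y ∈ (fderiv ℝ (fun u => e (F u)) 0).toLinearMap.range := by
  obtain ⟨hbij, hspec⟩ := ofChart_spec hF he heF
  rw [proj, LinearMap.comp_apply, Submodule.mkQ_apply, Submodule.Quotient.mk_eq_zero]
  constructor
  · rintro ⟨u, hu⟩
    exact ⟨u, hbij.1 ((hspec u).trans hu)⟩
  · rintro ⟨u, rfl⟩
    exact ⟨u, (hspec u).symm⟩

theorem mem_kerD_iff {F : X → M} (hF : MDifferentiableAt 𝓘(ℝ, X) (𝓡 m) F 0)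
    {e : OpenPartialHomeomorph M (EuclideanSpace ℝ (Fin m))}
    (he : e ∈ IsManifold.maximalAtlas (𝓡 m) ∞ M) (heF : F 0 ∈ e.source) (u : X) :
    u ∈ kerD m F ↔ fderiv ℝ (fun u => e (F u)) 0 u = 0 := by
  obtain ⟨hbij, hspec⟩ := ofChart_spec hF he heF
  rw [LinearMap.mem_ker, ← map_eq_zero_iff (ofChart e F) hbij.1, hspec]
  rfl

theorem contDiffAt_chart {F : X → M} (hF : ContMDiffAt 𝓘(ℝ, X) (𝓡 m) ∞ F 0)
    {e : OpenPartialHomeomorph M (EuclideanSpace ℝ (Fin m))}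
    (he : e ∈ IsManifold.maximalAtlas (𝓡 m) ∞ M) (heF : F 0 ∈ e.source) :
    ContDiffAt ℝ 4 (fun u => e (F u)) 0 := by
  have h1 : ContMDiffAt 𝓘(ℝ, X) 𝓘(ℝ, EuclideanSpace ℝ (Fin m)) ∞ (fun u => e (F u)) 0 :=
    (contMDiffAt_of_mem_maximalAtlas he heF).comp 0 hF
  exact h1.contDiffAt.of_le (WithTop.coe_le_coe.2 (le_top (a := (4 : ℕ∞))))

end Chart

end ThirdOrder

/-! ### The main theorem -/

theorem theorem1
    {X : Type*} [NormedAddCommGroup X] [NormedSpace ℝ X] [CompleteSpace X]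
    {m : ℕ} {M : Type*} [TopologicalSpace M] [ChartedSpace (EuclideanSpace ℝ (Fin m)) M]
    [IsManifold (𝓡 m) ∞ M]
    (U : Set X) (hU : IsOpen U) (h0 : (0 : X) ∈ U)
    (F : X → M) (hF : ContMDiffOn 𝓘(ℝ, X) (𝓡 m) ∞ F U)
    (h : ℕ) (hh : 1 ≤ h)
    (hcrit : ThirdOrder.IsCriticalAtZero m F) (hcorank : ThirdOrder.corank m F = h)
    -- an arbitrary smooth chart of `M` around `F 0`, in which the derivatives are computed
    (e : OpenPartialHomeomorph M (EuclideanSpace ℝ (Fin m)))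
    (he : e ∈ IsManifold.maximalAtlas (𝓡 m) ∞ M) (heF : F 0 ∈ e.source) :
    (h = 1 → (∃ v : ThirdOrder.dom e F, ThirdOrder.third e F v ≠ 0) →
      ThirdOrder.IsOpenAt F 0) ∧
    ((∃ w₀ ∈ ThirdOrder.Iso e F, ∃ v₀ : ThirdOrder.dom e F,
        ThirdOrder.IsRegularZero e F w₀ v₀) →
      ThirdOrder.IsOpenAt F 0) := by
  have hF0 : ContMDiffAt 𝓘(ℝ, X) (𝓡 m) ∞ F 0 := hF.contMDiffAt (hU.mem_nhds h0)
  have hFd : MDifferentiableAt 𝓘(ℝ, X) (𝓡 m) F 0 := hF0.mdifferentiableAt (by simp)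
  have hf := ThirdOrder.contDiffAt_chart hF0 he heF
  have hproj := ThirdOrder.proj_eq_zero_iff hFd he heF
  have hker := ThirdOrder.mem_kerD_iff hFd he heF
  refine ⟨fun h1 ⟨v, hv⟩ => ?_, fun ⟨w₀, hw₀, v₀, hv₀, hreg⟩ => ?_⟩
  · refine ThirdOrder.isOpenAt_of_chart hF0.continuousAt e heF ?_
    have hfin : Module.finrank ℝ (ThirdOrder.Coker m F) = 1 := hcorank.trans h1
    have : Module.Finite ℝ (ThirdOrder.Coker m F) := Module.finite_of_finrank_pos (by omega)
    obtain ⟨ι⟩ : Nonempty (ThirdOrder.Coker m F ≃ₗ[ℝ] ℝ) :=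
      ⟨LinearEquiv.ofFinrankEq _ _ (by rw [hfin, Module.finrank_self])⟩
    let φ : EuclideanSpace ℝ (Fin m) →L[ℝ] ℝ :=
      (ι.toLinearMap ∘ₗ ThirdOrder.proj e F).toContinuousLinearMap
    have hφ : ∀ y, φ y = 0 ↔
        y ∈ (fderiv ℝ (fun u => e (F u)) 0).toLinearMap.range := fun y => by
      rw [← hproj]
      exact ι.map_eq_zero_iff
    have hne : φ (ThirdOrder.chartD3 e F v v v) ≠ 0 := fun hz => hv (ι.map_eq_zero_iff.1 hz)
    have hvker := (hker v).1 v.2.1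
    have hvB := fun x => (hproj _).1 (v.2.2 x)
    -- `φ` and `-φ` have the same kernel, so the cubic value may be taken positive.
    rcases lt_or_gt_of_ne hne with hlt | hgt
    · refine ThirdOrder.isOpenAt_of_third_ne_zero hf (-φ) (fun y => ?_) hvker hvB ?_
      · rw [← hφ, neg_apply, neg_eq_zero]
      · rw [neg_apply]
        exact neg_pos.2 hlt
    · exact ThirdOrder.isOpenAt_of_third_ne_zero hf φ hφ hvker hvB hgt
  · refine ThirdOrder.isOpenAt_of_chart hF0.continuousAt e heF ?_
    refine ThirdOrder.isOpenAt_of_regularZero hf (v₀ := v₀) (w₀ := w₀) ((hker _).1 w₀.2)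
      ((hproj _).1 hw₀) ((hker _).1 v₀.2.1) (fun x => (hproj _).1 (v₀.2.2 x)) ((hproj _).1 hv₀)
      fun y => ?_
    -- Surjectivity onto the iterated quotient is lifted twice: modulo Im(F, 2, w₀) it yields `p`
    -- and then `w`, modulo the range of the differential it yields `u`.
    obtain ⟨p, hp⟩ := hreg (Submodule.Quotient.mk (ThirdOrder.proj e F y))
    obtain ⟨w, hw⟩ := (Submodule.Quotient.eq _).1 hp.symm
    have hz : ThirdOrder.proj e F
        (y - ThirdOrder.chartD3 e F v₀ v₀ p - ThirdOrder.chartD2 e F w₀ w) = 0 := by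
      rw [map_sub, map_sub]
      exact sub_eq_zero.2 hw.symm
    obtain ⟨u, hu⟩ := (hproj _).1 hz
    refine ⟨u, w, p, (hker _).1 w.2, (hker _).1 p.2.1, fun x => (hproj _).1 (p.2.2 x), ?_⟩
    change y = (fderiv ℝ (fun u => e (F u)) 0).toLinearMap u + ThirdOrder.chartD2 e F w₀ w +
      ThirdOrder.chartD3 e F v₀ v₀ p
    rw [hu]
    abel
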